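/- Let $S^1=\mathbb R/\mathbb Z$, let $\mathbb S=\{f\in L^2(S^1,\mathbb C):\|f\|_{L^2}=1\}$ be the unit sphere with tangent spaces $T_f\mathbb S=\{F\in L^2(S^1,\mathbb C):\mathrm{Re}\langle f,F\rangle=0\}$ and the round metric $g=\mathrm{Re}\langle\cdot,\cdot\rangle$, and let $\alpha_f(F)=\tfrac12\mathrm{Re}\langle \mathrm i f,F\rangle$ be the standard contact form, with $\|\alpha\|_\infty=\sup_f\|\alpha_f\|$. The Lorentz force $Y$ is defined by $g(Y_fu,v)=\mathrm d\alpha_f(u,v)$; a magnetic geodesic is a smooth curve $\gamma:\mathbb R\to\mathbb S$ with $\nabla_{\dot\gamma}\dot\gamma=Y_\gamma\dot\gamma$, and its energy is the constant $\tfrac12|\dot\gamma|^2$. For $k>0$ and $q_0,q_1\in\mathbb S$ let $\mathcal G_k(q_0,q_1)$ be the set of magnetic geodesics $\gamma$ of energy $k$ connecting $q_0$ and $q_1$, that is, with $\gamma(t_0)=q_0$ and $\gamma(t_1)=q_1$ for some real $t_0\ne t_1$ (in either order). Let $L(q,v)=\tfrac12|v|^2-\alpha_q(v)$ and let Mañé's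 critical value be $$c=\inf\Big\{k\in\mathbb R:\ \int_0^T\big(L(\gamma,\dot\gamma)+k\big)\,\mathrm dt\ge0\ \text{ for all } T>0 \text{ and all } \gamma\in H^1([0,T],\mathbb S) \text{ with } \gamma(0)=\gamma(T)\Big\}.$$ Then $c=\tfrac12\|\alpha\|_\infty^2=\tfrac18$. Moreover, for all $q_0,q_1\in\mathbb S$: 1. if $k>\tfrac18$, then $\mathcal G_k(q_0,q_1)\ne\varnothing$; 2. if $k=\tfrac18$, then $\mathcal G_k(q_0,q_1)\ne\varnothing$ if and only if $\langle q_0,q_1\rangle\ne0$; 3. if $0<k<\tfrac18$, then (a) if $|\langle q_0,q_1\rangle|>\sqrt{1-8k}$, then $\mathcal G_k(q_0,q_1)\ne\varnothing$; (b) there are $a_k,b_k\in\mathbb R$ with $b_k>0$, depending only on $k$, such that whenever $|\langle q_0,q_1\rangle|=\sqrt{1-8k}$, one has $\mathcal G_k(q_0,q_1)\ne\varnothing$ if and only if $\langle q_0,q_1\rangle=e^{\mathrm i(a_k+mb_k)}\sqrt{1-8k}$ for some $m\in\mathbb Z$; (c) if $|\langle q_0,q_1\rangle|<\sqrt{1-8k}$,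 then $\mathcal G_k(q_0,q_1)=\varnothing$. In particular, for $k>0$, all pairs of points of $\mathbb S$ are connected by a magnetic geodesic of energy $k$ if and only if $k>c$. -/

import Mathlib

open MeasureTheory
open scoped ENNReal

noncomputable section

namespace MagneticSphere

section Hilbert

attribute [local instance] InnerProductSpace.complexToReal

variable {H : Type*} [NormedAddCommGroup H] [InnerProductSpace ℂ H]

/-- The unit sphere of a complex Hilbert space `H`. The underlying real Hilbert space carries the
inner product `inner ℝ x y = Re (inner ℂ x y)`; its restriction to the tangent spaces of the
sphere is the round metric. -/
abbrev USphere (H : Type*) [NormedAddCommGroup H] : Type _ := Metric.sphere (0 : H) 1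

/-- The tangent space `T_f = {F | Re ⟨f, F⟩ = 0}` of the unit sphere, with the round metric. -/
abbrev Tan (f : USphere H) : Submodule ℝ H := (Submodule.span ℝ {(f : H)})ᗮ

theorem mem_tan_iff (f : USphere H) (F : H) :
    F ∈ Tan f ↔ (inner ℂ (f : H) F).re = 0 :=
  Submodule.mem_orthogonal_singleton_iff_inner_right

/-- The one-form `z ↦ (v ↦ ½ Re ⟨i z, v⟩)` on the ambient space. -/
def ambientForm (z : H) : H →L[ℝ] ℝ := (1 / 2 : ℝ) • innerSL ℝ (Complex.I • z)

/-- The standard contact form `α_f(F) = ½ Re ⟨i f, F⟩` on the unit sphere. -/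
def contactForm (f : USphere H) : Tan f →L[ℝ] ℝ :=
  (ambientForm (f : H)).comp (Tan f).subtypeL

/-- `‖α‖_∞`, the supremum over the sphere of the operator norms of `α_f` on `T_f`. -/
def contactFormSupNorm (H : Type*) [NormedAddCommGroup H] [InnerProductSpace ℂ H] : ℝ≥0∞ :=
  ⨆ f : USphere H, ‖contactForm f‖ₑ

/-- The magnetic field `dα`, as the map `u ↦ dα_f(u, ·)`. Exterior differentiation commutes with
restriction to a submanifold, so `dα` is the restriction to the tangent spaces of the exterior
derivative of the ambient one-form that restricts to `α`. -/
def magneticField (f : USphere H) (u : Tan f) : Tan f →L[ℝ] ℝ :=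
  ((ContinuousAlternatingMap.ofSubsingleton ℝ H ℝ (0 : Fin 1)).symm
    ((extDeriv (fun z : H => ContinuousAlternatingMap.ofSubsingleton ℝ H ℝ (0 : Fin 1)
      (ambientForm z)) (f : H)).curryLeft (u : H))).comp (Tan f).subtypeL

/-- The Lorentz force: `Y_f u` is the vector of `T_f` that represents `dα_f(u, ·)` with respect to
the round metric. -/
def lorentzForce [CompleteSpace H] (f : USphere H) (u : Tan f) : Tan f :=
  (InnerProductSpace.toDual ℝ (Tan f)).symm (magneticField f u)

/-- The defining property of the Lorentz force, `g(Y_f u, v) = dα_f(u, v)`. -/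
theorem inner_lorentzForce [CompleteSpace H] (f : USphere H) (u v : Tan f) :
    inner ℝ (lorentzForce f u) v = magneticField f u v :=
  InnerProductSpace.toDual_symm_apply

theorem deriv_mem_tan (γ : ℝ → USphere H) (t : ℝ) :
    deriv (fun s => (γ s : H)) t ∈ Tan (γ t) := by
  rw [Submodule.mem_orthogonal_singleton_iff_inner_right]
  by_cases hd : DifferentiableAt ℝ (fun s => (γ s : H)) t
  · have h1 := hd.hasDerivAt.inner ℝ hd.hasDerivAt
    have h2 : (fun s => inner ℝ (γ s : H) (γ s : H)) = fun _ => (1 : ℝ) := by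
      funext s
      rw [real_inner_self_eq_norm_sq, norm_eq_of_mem_sphere]
      norm_num
    rw [h2] at h1
    have h3 := h1.unique (hasDerivAt_const t (1 : ℝ))
    rw [real_inner_comm (γ t : H) (deriv (fun s => (γ s : H)) t)] at h3
    linarith
  · rw [deriv_zero_of_not_differentiableAt hd, inner_zero_right]

/-- The velocity of a curve on the sphere, a vector field along the curve. -/
def velocity (γ : ℝ → USphere H) (t : ℝ) : Tan (γ t) :=
  ⟨deriv (fun s => (γ s : H)) t, deriv_mem_tan γ t⟩

/-- The Levi-Civita covariant derivative of a vector field `V` along a curve on the sphere: the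
orthogonal projection of the ambient derivative of `V` to the tangent space. -/
def covDeriv (γ : ℝ → USphere H) (V : ∀ t, Tan (γ t)) (t : ℝ) : Tan (γ t) :=
  (Tan (γ t)).orthogonalProjectionOnto (deriv (fun s => (V s : H)) t)

/-- Magnetic geodesics: smooth curves `γ : ℝ → S` with `∇_{γ'} γ' = Y_γ γ'`. -/
def IsMagneticGeodesic [CompleteSpace H] (γ : ℝ → USphere H) : Prop :=
  ContDiff ℝ (⊤ : ℕ∞) (fun t => (γ t : H)) ∧
    ∀ t, covDeriv γ (velocity γ) t = lorentzForce (γ t) (velocity γ t)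

/-- `𝒢_k(q₀, q₁)`: the magnetic geodesics of kinetic energy `k` that pass through `q₀` and `q₁`
(at two different times). -/
def connectingGeodesics [CompleteSpace H] (k : ℝ) (q₀ q₁ : USphere H) : Set (ℝ → USphere H) :=
  {γ | IsMagneticGeodesic γ ∧ (∀ t, (1 / 2) * ‖velocity γ t‖ ^ 2 = k) ∧
    ∃ t₀ t₁ : ℝ, t₀ ≠ t₁ ∧ γ t₀ = q₀ ∧ γ t₁ = q₁}

/-- The magnetic Lagrangian `L(q, v) = ½ |v|² - α_q(v)`. -/
def lagrangian (q : USphere H) (v : Tan q) : ℝ := (1 / 2) * ‖v‖ ^ 2 - contactForm q v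

/-- `γ`, restricted to `[0, T]`, is a curve of Sobolev class `H¹` on the sphere, with weak
derivative `V` (a square integrable vector field along `γ`). -/
def IsH1Curve (T : ℝ) (γ : ℝ → USphere H) (V : ∀ t, Tan (γ t)) : Prop :=
  MemLp (fun t => (V t : H)) 2 (volume.restrict (Set.Icc 0 T)) ∧
    ∀ t ∈ Set.Icc 0 T, (γ t : H) = (γ 0 : H) + ∫ s in (0 : ℝ)..t, (V s : H)

/-- The action `S_{L+k}` over `[0, T]` of a curve `γ` with weak derivative `V`. -/
def action (k T : ℝ) (γ : ℝ → USphere H) (V : ∀ t, Tan (γ t)) : ℝ :=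
  ∫ t in (0 : ℝ)..T, (lagrangian (γ t) (V t) + k)

/-- Mañé's critical value: the infimum of the energies `k` for which `S_{L+k}` is nonnegative on
all `H¹` loops of every period `T > 0`. The infimum is taken in the extended reals. -/
def maneCriticalValue (H : Type*) [NormedAddCommGroup H] [InnerProductSpace ℂ H] : EReal :=
  sInf ((fun k : ℝ => (k : EReal)) '' {k : ℝ | ∀ T > 0, ∀ (γ : ℝ → USphere H)
    (V : ∀ t, Tan (γ t)), IsH1Curve T γ V → γ 0 = γ T → 0 ≤ action k T γ V})

end Hilbert

/-- The complex Hilbert space `L²(S¹, ℂ)`, where `S¹ = ℝ/ℤ`. -/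
abbrev L2Circle : Type := Lp ℂ 2 (volume : Measure UnitAddCircle)

end MagneticSphere

end

/-!
The exterior derivative of the contact form is `dα(u, v) = Re ⟨i u, v⟩`, so the Lorentz force is the
tangential part of multiplication by `i`. Along a magnetic geodesic of
energy `k` the number `s = Im ⟨γ, γ'⟩` is conserved, and the geodesic equation becomes the linear
equation `γ'' = i γ' + (s - 2 k) γ` (`exists_linear_equation`). Pairing it with a point `q₀ = γ t₀`
gives a scalar equation for `⟨q₀, γ⟩`, whose solution is
`exp (i τ / 2) (cos (ω τ) + i r sin (ω τ))` with `|r| ≤ 1` and `1/4 + ω² + ω r = 2 k`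
(`exists_parameters_of_nonempty`). Conversely, superpositions of two orthogonal modes with
frequencies `1/2 ± ω` are magnetic geodesics, and two non-parallel points whose inner product has
this form lie on such a curve (`connectingGeodesics_nonempty_of_parameters`). The question is thus
which complex numbers `w` of modulus at most `1` have this form.

The energy equation has a real root `ω` only if `r² ≥ 1 - 8 k`, and
`|w|² = cos² (ω τ) + r² sin² (ω τ) ≥ r²`. This excludes `|w| < √(1 - 8 k)`, and leaves a discrete
set of arguments when `|w| = √(1 - 8 k) > 0`. If `√(1 - 8 k) < |w| < 1`, an interval of parameters
`r` realizes the modulus `|w|`, and the argument of `w` is reached by the intermediate value theorem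
after enough periods (`connectingGeodesics_nonempty_of_lt_norm_inner`). Parallel points are joined
by a Hopf circle. For `k > 1/8` and `w = 0` one takes `r = 0`. For `k = 1/8` and `w = 0` the
equations would force `r = 0` and then `ω = 0`, where `w = exp (i τ / 2)`.

For the critical value, `α_f` has norm `1/2`, so the Lagrangian is at least
`½ (|v| - ½)² - ⅛`, with equality along the Hopf circles traversed at speed `½`, which are closed
(`action_nonneg`, `exists_loop_action`). Orthogonal points of the sphere show that connectedness
fails for `k ≤ 1/8`.
-/

noncomputable section

namespace MagneticSphere

/-! ### The geodesic equation -/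

section Geometry

attribute [local instance] InnerProductSpace.complexToReal

variable {H : Type*} [NormedAddCommGroup H] [InnerProductSpace ℂ H]

theorem ambientForm_apply (z v : H) :
    ambientForm z v = 1 / 2 * inner ℝ (Complex.I • z) v := by
  simp [ambientForm]

theorem real_inner_I_smul_left (u v : H) :
    inner ℝ (Complex.I • u) v = (inner ℂ u v).im := by
  rw [real_inner_eq_re_inner ℂ, inner_smul_left]
  simp

theorem real_inner_I_smul_right (u v : H) :
    inner ℝ u (Complex.I • v) = -(inner ℂ u v).im := by
  rw [real_inner_eq_re_inner ℂ, inner_smul_right]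
  simp

/-- The field `dα` is the standard symplectic form `dα(u, v) = Re ⟨i u, v⟩`: the factor `½` in `α`
cancels against the two equal terms of the exterior derivative. -/
theorem magneticField_apply (f : USphere H) (u v : Tan f) :
    magneticField f u v = inner ℝ (Complex.I • (u : H)) (v : H) := by
  -- The ambient form is linear in the base point, so it is its own derivative.
  let L : H →L[ℝ] H →L[ℝ] ℝ :=
    (1 / 2 : ℝ) • (innerSL ℝ).comp ((Complex.I • ContinuousLinearMap.id ℂ H).restrictScalars ℝ)
  have hL : ∀ z, ambientForm z = L z := fun z => by
    simp [L, ambientForm]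
  let M : H →L[ℝ] H [⋀^Fin 1]→L[ℝ] ℝ :=
    (ContinuousAlternatingMap.ofSubsingletonLIE (𝕜 := ℝ) (E := H) (F := ℝ)
      (0 : Fin 1)).toContinuousLinearEquiv.toContinuousLinearMap.comp L
  have hM : (fun z : H => ContinuousAlternatingMap.ofSubsingleton ℝ H ℝ (0 : Fin 1)
      (ambientForm z)) = M := by
    funext z
    simp only [hL]
    rfl
  have hfd : fderiv ℝ M (f : H) = M := M.fderiv
  have h1 : ∀ x y : H, ((ContinuousAlternatingMap.ofSubsingleton ℝ H ℝ (0 : Fin 1)).symm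
    ((extDeriv M (f : H)).curryLeft x)) y = extDeriv M (f : H) ![x, y] := by
    intro x y
    change extDeriv M (f : H) (Matrix.vecCons x (fun _ => y)) = _
    congr 1
    ext i
    fin_cases i <;> rfl
  have h2 : ∀ x y : H, M x (fun _ => y) = 1 / 2 * (inner ℂ x y).im := fun x y => by
    change L x y = _
    rw [← hL, ambientForm_apply, real_inner_I_smul_left]
  have h3 : magneticField f u v = extDeriv M (f : H) ![(u : H), (v : H)] := by
    rw [← h1, ← hM]
    rfl
  rw [h3, extDeriv, ContinuousAlternatingMap.alternatizeUncurryFin_apply, hfd,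
    Fin.sum_univ_two]
  have e0 : Fin.removeNth 0 ![(u : H), (v : H)] = fun _ => (v : H) := by
    ext i; fin_cases i; rfl
  have e1 : Fin.removeNth 1 ![(u : H), (v : H)] = fun _ => (u : H) := by
    ext i; fin_cases i; rfl
  rw [e0, e1, Matrix.cons_val_zero, Matrix.cons_val_one, Matrix.cons_val_zero, h2, h2,
    real_inner_I_smul_left, ← inner_conj_symm (v : H) (u : H), Complex.conj_im]
  simp
  ring

theorem coe_orthogonalProjectionOnto_tan (f : USphere H) (x : H) :
    ((Tan f).orthogonalProjectionOnto x : H) = x - inner ℝ (f : H) x • (f : H) := by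
  have h : ((Tan f).orthogonalProjectionOnto x : H) = (Tan f).starProjection x := rfl
  rw [h, Submodule.starProjection_orthogonal_val, Submodule.starProjection_unit_singleton ℝ]
  simp

theorem coe_lorentzForce [CompleteSpace H] (f : USphere H) (u : Tan f) :
    (lorentzForce f u : H) =
      Complex.I • (u : H) - inner ℝ (f : H) (Complex.I • (u : H)) • (f : H) := by
  rw [← coe_orthogonalProjectionOnto_tan]
  congr 1
  refine ext_inner_right ℝ fun v => ?_
  rw [inner_lorentzForce, magneticField_apply,
    Submodule.inner_orthogonalProjectionOnto_eq_of_mem_right]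

/-- The equation of magnetic geodesics in terms of the ambient derivatives of the curve. -/
theorem isMagneticGeodesic_iff [CompleteSpace H] (γ : ℝ → USphere H) :
    IsMagneticGeodesic γ ↔ ContDiff ℝ (⊤ : ℕ∞) (fun t => (γ t : H)) ∧ ∀ t,
      deriv (deriv fun s => (γ s : H)) t
          - inner ℝ (γ t : H) (deriv (deriv fun s => (γ s : H)) t) • (γ t : H) =
        Complex.I • deriv (fun s => (γ s : H)) t
          - inner ℝ (γ t : H) (Complex.I • deriv (fun s => (γ s : H)) t) • (γ t : H) := by
  refine and_congr_right fun _ => forall_congr' fun t => ?_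
  rw [Subtype.ext_iff, coe_lorentzForce, covDeriv, coe_orthogonalProjectionOnto_tan]
  rfl

end Geometry

/-! ### Two-mode curves -/

section Modes

attribute [local instance] InnerProductSpace.complexToReal

variable {H : Type*} [NormedAddCommGroup H] [InnerProductSpace ℂ H]

/-- The unimodular number `exp (i x)`. -/
def phase (x : ℝ) : ℂ := Complex.exp (Complex.I * (x : ℂ))

theorem phase_zero : phase 0 = 1 := by simp [phase]

theorem phase_add (x y : ℝ) : phase (x + y) = phase x * phase y := by
  rw [phase, phase, phase, ← Complex.exp_add]
  congr 1
  push_cast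
  ring

theorem phase_ne_zero (x : ℝ) : phase x ≠ 0 := Complex.exp_ne_zero _

theorem norm_phase (x : ℝ) : ‖phase x‖ = 1 := by
  rw [phase, mul_comm, Complex.norm_exp_ofReal_mul_I]

theorem phase_eq (x : ℝ) : phase x = (Real.cos x : ℂ) + Complex.I * (Real.sin x : ℂ) := by
  rw [phase, mul_comm, Complex.exp_mul_I]
  push_cast
  ring

theorem conj_phase (x : ℝ) : (starRingEnd ℂ) (phase x) = phase (-x) := by
  rw [phase, phase, ← Complex.exp_conj, map_mul, Complex.conj_I, Complex.conj_ofReal]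
  push_cast
  rw [neg_mul, mul_neg]

theorem phase_neg_mul_self (x : ℝ) : phase (-x) * phase x = 1 := by
  rw [← phase_add, neg_add_cancel, phase_zero]

theorem hasDerivAt_phase_mul (a t : ℝ) :
    HasDerivAt (fun s : ℝ => phase (a * s)) (Complex.I * a * phase (a * t)) t := by
  have h1 : HasDerivAt (fun s : ℝ => Complex.I * ((a * s : ℝ) : ℂ)) (Complex.I * a) t := by
    have h := ((hasDerivAt_id t).const_mul a).ofReal_comp.const_mul Complex.I
    simpa using h
  have h2 := h1.cexp
  rw [mul_comm] at h2
  exact h2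

/-- The curve `exp (i a t) A + exp (i b t) B`. -/
def twoMode (a b : ℝ) (A B : H) (t : ℝ) : H := phase (a * t) • A + phase (b * t) • B

theorem hasDerivAt_twoMode (a b : ℝ) (A B : H) (t : ℝ) :
    HasDerivAt (twoMode a b A B)
      (twoMode a b ((Complex.I * a) • A) ((Complex.I * b) • B) t) t := by
  have h := ((hasDerivAt_phase_mul a t).smul_const A).add
    ((hasDerivAt_phase_mul b t).smul_const B)
  refine h.congr_deriv ?_
  simp only [twoMode, smul_smul]
  congr 2 <;> ring

theorem deriv_twoMode (a b : ℝ) (A B : H) :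
    deriv (twoMode a b A B) = twoMode a b ((Complex.I * a) • A) ((Complex.I * b) • B) :=
  funext fun t => (hasDerivAt_twoMode a b A B t).deriv

theorem contDiff_twoMode (a b : ℝ) (A B : H) {n : ℕ∞} : ContDiff ℝ n (twoMode a b A B) := by
  have h : ∀ c : ℝ, ContDiff ℝ n (fun t : ℝ => phase (c * t)) := fun c =>
    (contDiff_const.mul (Complex.ofRealCLM.contDiff.comp (contDiff_const.mul contDiff_id))).cexp
  exact ((h a).smul contDiff_const).add ((h b).smul contDiff_const)

theorem inner_twoMode (a b : ℝ) {A B : H} (hAB : inner ℂ A B = 0) (t₀ t₁ : ℝ) :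
    inner ℂ (twoMode a b A B t₀) (twoMode a b A B t₁) =
      phase (a * (t₁ - t₀)) * (‖A‖ ^ 2 : ℝ) + phase (b * (t₁ - t₀)) * (‖B‖ ^ 2 : ℝ) := by
  have hBA : inner ℂ B A = 0 := inner_eq_zero_symm.mp hAB
  have h : ∀ c : ℝ, phase (c * (t₁ - t₀)) = phase (-(c * t₀)) * phase (c * t₁) := fun c => by
    rw [← phase_add]
    congr 1
    ring
  simp only [twoMode, inner_add_left, inner_add_right, inner_smul_left, inner_smul_right, hAB, hBA,
    conj_phase, h, inner_self_eq_norm_sq_to_K]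
  push_cast
  simp
  ring

theorem norm_sq_twoMode (a b : ℝ) {A B : H} (hAB : inner ℂ A B = 0) (t : ℝ) :
    ‖twoMode a b A B t‖ ^ 2 = ‖A‖ ^ 2 + ‖B‖ ^ 2 := by
  have h := inner_twoMode a b hAB t t
  rw [inner_self_eq_norm_sq_to_K] at h
  simp only [sub_self, mul_zero, phase_zero, one_mul] at h
  exact Complex.ofReal_injective (by simpa using h)

theorem norm_I_mul_smul_sq (a : ℝ) (A : H) : ‖(Complex.I * (a : ℂ)) • A‖ ^ 2 = a ^ 2 * ‖A‖ ^ 2 := by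
  rw [norm_smul, mul_pow]
  simp

/-- A superposition of orthogonal modes with frequencies `a + b = 1` is a magnetic geodesic: both
frequencies satisfy `x - x² = a b`, so the curve solves `c'' = i c' + a b c`, and the last term is
normal to the sphere. -/
theorem twoMode_isMagneticGeodesic [CompleteSpace H] {a b : ℝ} {A B : H} (hab : a + b = 1)
    (hAB : inner ℂ A B = 0) (hn : ‖A‖ ^ 2 + ‖B‖ ^ 2 = 1) :
    ∃ γ : ℝ → USphere H, (∀ t, (γ t : H) = twoMode a b A B t) ∧ IsMagneticGeodesic γ ∧
      ∀ t, ‖velocity γ t‖ ^ 2 = a ^ 2 * ‖A‖ ^ 2 + b ^ 2 * ‖B‖ ^ 2 := by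
  have hmem : ∀ t, ‖twoMode a b A B t‖ = 1 := fun t => by
    have h := norm_sq_twoMode a b hAB t
    rw [hn] at h
    exact (pow_eq_one_iff_of_nonneg (norm_nonneg _) two_ne_zero).mp h
  refine ⟨fun t => ⟨twoMode a b A B t, by simpa using hmem t⟩, fun t => rfl, ?_, fun t => ?_⟩
  · rw [isMagneticGeodesic_iff]
    refine ⟨contDiff_twoMode a b A B, fun t => ?_⟩
    change deriv (deriv (twoMode a b A B)) t
      - inner ℝ (twoMode a b A B t) (deriv (deriv (twoMode a b A B)) t) • twoMode a b A B t =
      Complex.I • deriv (twoMode a b A B) t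
      - inner ℝ (twoMode a b A B t) (Complex.I • deriv (twoMode a b A B) t) • twoMode a b A B t
    have h2 : deriv (deriv (twoMode a b A B)) t =
        Complex.I • deriv (twoMode a b A B) t + (a * b : ℝ) • twoMode a b A B t := by
      simp only [deriv_twoMode, ← Complex.coe_smul (a * b)]
      obtain rfl : b = 1 - a := by linarith
      simp only [twoMode, smul_add, smul_smul]
      rw [add_add_add_comm, ← add_smul, ← add_smul]
      have hI := Complex.I_mul_I
      congr 2
      · push_cast
        linear_combination (phase (a * t) * a * (a - 1)) * hI
      · push_cast
        linear_combination (phase ((1 - a) * t) * (1 - a) * (-a)) * hI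
    rw [h2, inner_add_right, real_inner_smul_right, real_inner_self_eq_norm_sq, hmem t]
    module
  · change ‖deriv (twoMode a b A B) t‖ ^ 2 = _
    rw [deriv_twoMode, norm_sq_twoMode, norm_I_mul_smul_sq, norm_I_mul_smul_sq]
    rw [inner_smul_left, inner_smul_right, hAB, mul_zero, mul_zero]

/-- Two points are joined by a two-mode curve as soon as their inner product is that of such a
curve at times `0` and `τ` at which the two modes have different phases: these conditions determine
the amplitudes. -/
theorem connectingGeodesics_nonempty_of_modes [CompleteSpace H] {k a b p τ : ℝ}
    {q₀ q₁ : USphere H} (hab : a + b = 1) (hk : p * a ^ 2 + (1 - p) * b ^ 2 = 2 * k)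
    (hne : phase (a * τ) ≠ phase (b * τ))
    (hw : inner ℂ (q₀ : H) (q₁ : H) = p * phase (a * τ) + (1 - p) * phase (b * τ)) :
    (connectingGeodesics k q₀ q₁).Nonempty := by
  have hd : phase (a * τ) - phase (b * τ) ≠ 0 := sub_ne_zero.mpr hne
  have hc₁ := conj_phase (a * τ)
  have hc₂ := conj_phase (b * τ)
  have hm₁ := phase_neg_mul_self (a * τ)
  have hm₂ := phase_neg_mul_self (b * τ)
  have hτ : τ ≠ 0 := by
    rintro rfl
    simp at hne
  have hw' : inner ℂ (q₁ : H) (q₀ : H) = p * phase (-(a * τ)) + (1 - p) * phase (-(b * τ)) := by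
    rw [← inner_conj_symm, hw]
    simp [conj_phase]
  set e₁ := phase (a * τ)
  set e₂ := phase (b * τ)
  set A : H := (e₁ - e₂)⁻¹ • ((q₁ : H) - e₂ • (q₀ : H)) with hA
  set B : H := (e₁ - e₂)⁻¹ • (e₁ • (q₀ : H) - (q₁ : H)) with hB
  have hsum : A + B = q₀ := by
    rw [hA, hB, ← smul_add, inv_smul_eq_iff₀ hd]
    module
  have hsum' : e₁ • A + e₂ • B = q₁ := by
    rw [hA, hB, smul_comm e₁, smul_comm e₂, ← smul_add, inv_smul_eq_iff₀ hd]
    module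
  have hAB : inner ℂ A B = 0 := by
    rw [hA, hB, inner_smul_left, inner_smul_right]
    have : inner ℂ ((q₁ : H) - e₂ • (q₀ : H)) (e₁ • (q₀ : H) - (q₁ : H)) = 0 := by
      simp only [inner_sub_left, inner_sub_right, inner_smul_left, inner_smul_right, hw, hw', hc₂,
        inner_self_eq_norm_sq_to_K, norm_eq_of_mem_sphere]
      push_cast
      linear_combination (p : ℂ) * hm₁ + (1 - p) * hm₂
    rw [this, mul_zero, mul_zero]
  have h0 : twoMode a b A B 0 = q₀ := by
    simp [twoMode, phase_zero, hsum]
  have h1 : twoMode a b A B τ = q₁ := hsum'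
  have hn : ‖A‖ ^ 2 + ‖B‖ ^ 2 = 1 := by
    rw [← norm_sq_twoMode a b hAB 0, h0, norm_eq_of_mem_sphere, one_pow]
  have hp : ‖A‖ ^ 2 = p := by
    have h := inner_twoMode a b hAB 0 τ
    rw [h0, h1, hw, sub_zero, eq_sub_iff_add_eq'.mpr hn] at h
    push_cast at h
    have h' : (e₁ - e₂) * ((‖A‖ ^ 2 : ℝ) - p : ℂ) = 0 := by
      push_cast
      linear_combination -h
    have h'' := (mul_eq_zero.mp h').resolve_left hd
    exact_mod_cast sub_eq_zero.mp h''
  obtain ⟨γ, hγ, hgeo, hvel⟩ := twoMode_isMagneticGeodesic hab hAB hn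
  refine ⟨γ, hgeo, fun t => ?_, 0, τ, hτ.symm, Subtype.ext ?_, Subtype.ext ?_⟩
  · rw [hvel, eq_sub_iff_add_eq'.mpr hn, hp]
    linarith
  · rw [hγ, h0]
  · rw [hγ, h1]

/-- Points on the same Hopf circle are joined by an arc of that circle, at every energy. -/
theorem connectingGeodesics_nonempty_of_norm_inner_eq_one [CompleteSpace H] {k : ℝ} (hk : 0 < k)
    {q₀ q₁ : USphere H} (hw : ‖inner ℂ (q₀ : H) (q₁ : H)‖ = 1) :
    (connectingGeodesics k q₀ q₁).Nonempty := by
  set a := √(2 * k) with ha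
  have ha0 : 0 < a := Real.sqrt_pos.mpr (by linarith)
  have hq₀ : ‖(q₀ : H)‖ = 1 := norm_eq_of_mem_sphere q₀
  have hq₁ : ‖(q₁ : H)‖ = 1 := norm_eq_of_mem_sphere q₁
  have hpar : (q₁ : H) = inner ℂ (q₀ : H) (q₁ : H) • (q₀ : H) := by
    have h : inner ℂ (inner ℂ (q₀ : H) (q₁ : H) • (q₀ : H)) (q₁ : H) = 1 := by
      rw [inner_smul_left, Complex.conj_mul', hw]
      simp
    exact ((inner_eq_one_iff_of_norm_eq_one (by rw [norm_smul, hw, hq₀, one_mul]) hq₁).mp h).symm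
  obtain ⟨x, hx0, hx⟩ : ∃ x : ℝ, x ≠ 0 ∧ inner ℂ (q₀ : H) (q₁ : H) = phase x := by
    set w := inner ℂ (q₀ : H) (q₁ : H)
    have h : w = phase w.arg := by
      rw [phase, mul_comm]
      conv_lhs => rw [← Complex.norm_mul_exp_arg_mul_I w, hw, Complex.ofReal_one, one_mul]
    -- A full turn replaces the zero angle, since the two times have to differ.
    by_cases h0 : w.arg = 0
    · refine ⟨2 * Real.pi, by positivity, ?_⟩
      rw [h, h0, phase_zero, phase_eq]
      simp
    · exact ⟨w.arg, h0, h⟩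
  obtain ⟨γ, hγ, hgeo, hvel⟩ := twoMode_isMagneticGeodesic (a := a) (b := 1 - a) (A := (q₀ : H))
    (B := 0) (by ring) (inner_zero_right _) (by simp)
  refine ⟨γ, hgeo, fun t => ?_, 0, x / a, (div_ne_zero hx0 ha0.ne').symm, Subtype.ext ?_,
    Subtype.ext ?_⟩
  · rw [hvel, hq₀, ha, Real.sq_sqrt (by linarith)]
    simp
  · simp [hγ, twoMode, phase_zero]
  · rw [hγ, twoMode, hpar, hx, mul_div_cancel₀ _ ha0.ne', smul_zero, add_zero]

end Modes

/-! ### Inner products along a magnetic geodesic -/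

section Necessity

attribute [local instance] InnerProductSpace.complexToReal

variable {H : Type*} [NormedAddCommGroup H] [InnerProductSpace ℂ H]

/-- The solution of `y'' = -ω² y`, multiplied by `ω` so that no case distinction is needed; it says
nothing for `ω = 0`. -/
theorem harmonic_oscillator_solution {y z : ℝ → ℂ} {ω : ℝ} (hy : ∀ t, HasDerivAt y (z t) t)
    (hz : ∀ t, HasDerivAt z (-(ω : ℂ) ^ 2 * y t) t) (t₀ t : ℝ) :
    ω * y t = ω * Real.cos (ω * (t - t₀)) * y t₀ + Real.sin (ω * (t - t₀)) * z t₀ := by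
  have hlin : ∀ s, HasDerivAt (fun s : ℝ => ω * (s - t₀)) ω s := fun s => by
    simpa using ((hasDerivAt_id s).sub_const t₀).const_mul ω
  have hcos : ∀ s, HasDerivAt (fun s : ℝ => ((Real.cos (ω * (s - t₀)) : ℝ) : ℂ))
      ((-Real.sin (ω * (s - t₀)) * ω : ℝ) : ℂ) s := fun s => (hlin s).cos.ofReal_comp
  have hsin : ∀ s, HasDerivAt (fun s : ℝ => ((Real.sin (ω * (s - t₀)) : ℝ) : ℂ))
      ((Real.cos (ω * (s - t₀)) * ω : ℝ) : ℂ) s := fun s => (hlin s).sin.ofReal_comp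
  have hF : ∀ s, HasDerivAt (fun s : ℝ => ω * Real.cos (ω * (s - t₀)) * y s
      - Real.sin (ω * (s - t₀)) * z s) 0 s := fun s => by
    refine ((((hcos s).const_mul (ω : ℂ)).mul (hy s)).sub ((hsin s).mul (hz s))).congr_deriv ?_
    push_cast
    ring
  have hG : ∀ s, HasDerivAt (fun s : ℝ => ω * Real.sin (ω * (s - t₀)) * y s
      + Real.cos (ω * (s - t₀)) * z s) 0 s := fun s => by
    refine ((((hsin s).const_mul (ω : ℂ)).mul (hy s)).add ((hcos s).mul (hz s))).congr_deriv ?_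
    push_cast
    ring
  have hF' := is_const_of_deriv_eq_zero (fun s => (hF s).differentiableAt)
    (fun s => (hF s).deriv) t t₀
  have hG' := is_const_of_deriv_eq_zero (fun s => (hG s).differentiableAt)
    (fun s => (hG s).deriv) t t₀
  simp only [sub_self, mul_zero, Real.cos_zero, Real.sin_zero] at hF' hG'
  have hcs : (Real.cos (ω * (t - t₀)) : ℂ) ^ 2 + (Real.sin (ω * (t - t₀)) : ℂ) ^ 2 = 1 := by
    exact_mod_cast Real.cos_sq_add_sin_sq _
  push_cast at hF' hG' hcs ⊢
  linear_combination (Complex.cos (ω * (t - t₀))) * hF' + Complex.sin (ω * (t - t₀)) * hG'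
    - ω * y t * hcs

/-- Along a magnetic geodesic `γ` of energy `k` the quantity `s = Im ⟨γ, γ'⟩` is conserved, so that
the geodesic equation becomes linear, `γ'' = i γ' + (s - 2 k) γ`. -/
theorem exists_linear_equation [CompleteSpace H] {k : ℝ} {γ : ℝ → USphere H}
    (hγ : IsMagneticGeodesic γ) (hk : ∀ t, (1 / 2) * ‖velocity γ t‖ ^ 2 = k) :
    ∃ s : ℝ, s ^ 2 ≤ 2 * k ∧ ∃ c' : ℝ → H, (∀ t, HasDerivAt (fun t => (γ t : H)) (c' t) t) ∧
      (∀ t, HasDerivAt c' (Complex.I • c' t + (s - 2 * k) • (γ t : H)) t) ∧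
      ∀ t, inner ℂ (γ t : H) (c' t) = Complex.I * s := by
  obtain ⟨hsm, heq⟩ := (isMagneticGeodesic_iff γ).mp hγ
  set c : ℝ → H := fun t => (γ t : H) with hc
  set c' : ℝ → H := deriv c with hc'
  have hd : ∀ t, HasDerivAt c (c' t) t := fun t =>
    ((hsm.differentiable (by simp)) t).hasDerivAt
  have hd' : ∀ t, HasDerivAt c' (deriv c' t) t := fun t => by
    have h : ContDiff ℝ 1 c' := ((contDiff_succ_iff_deriv (n := 1)).mp
      (hsm.of_le (WithTop.coe_le_coe.mpr le_top))).2.2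
    exact ((h.differentiable one_ne_zero) t).hasDerivAt
  have hnorm : ∀ t, ‖c t‖ = 1 := fun t => norm_eq_of_mem_sphere (γ t)
  have hk' : ∀ t, ‖c' t‖ ^ 2 = 2 * k := fun t => by
    have h : (1 / 2) * ‖c' t‖ ^ 2 = k := hk t
    linarith
  have hre : ∀ t, inner ℝ (c t) (c' t) = 0 := fun t =>
    Submodule.mem_orthogonal_singleton_iff_inner_right.mp (deriv_mem_tan γ t)
  have hrr : ∀ t, inner ℝ (c t) (deriv c' t) = -(2 * k) := fun t => by
    have h := (hd t).inner ℝ (hd' t)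
    rw [funext hre] at h
    have h' := h.unique (hasDerivAt_const t 0)
    rw [real_inner_self_eq_norm_sq, hk'] at h'
    linarith
  have hin : ∀ t, inner ℂ (c t) (c' t) = Complex.I * ((inner ℂ (c t) (c' t)).im : ℝ) := fun t => by
    have h : (inner ℂ (c t) (c' t)).re = 0 := hre t
    apply Complex.ext <;> simp [h]
  have hode : ∀ t, deriv c' t =
      Complex.I • c' t + ((inner ℂ (c t) (c' t)).im - 2 * k) • c t := fun t => by
    have h := heq t
    change deriv c' t - inner ℝ (c t) (deriv c' t) • c t =
      Complex.I • c' t - inner ℝ (c t) (Complex.I • c' t) • c t at h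
    rw [hrr, real_inner_I_smul_right, sub_eq_iff_eq_add] at h
    rw [h]
    module
  have hS : ∀ t, HasDerivAt (fun t => (inner ℂ (c t) (c' t)).im) 0 t := fun t => by
    have h := Complex.imCLM.hasFDerivAt.comp_hasDerivAt t ((hd t).inner ℂ (hd' t))
    refine h.congr_deriv ?_
    rw [hode, inner_add_right, inner_smul_right, inner_smul_right_eq_smul, hin,
      inner_self_eq_norm_sq_to_K, inner_self_eq_norm_sq_to_K, hnorm]
    simp [← Complex.ofReal_pow]
  have hconst : ∀ t, (inner ℂ (c t) (c' t)).im = (inner ℂ (c 0) (c' 0)).im := fun t =>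
    is_const_of_deriv_eq_zero (fun s => (hS s).differentiableAt) (fun s => (hS s).deriv) t 0
  refine ⟨(inner ℂ (c 0) (c' 0)).im, ?_, c', hd, fun t => ?_, fun t => ?_⟩
  · have h1 := (Complex.abs_im_le_norm (inner ℂ (c 0) (c' 0))).trans (norm_inner_le_norm _ _)
    rw [hnorm, one_mul] at h1
    rw [← hk' 0]
    exact sq_le_sq' (by linarith [neg_abs_le (inner ℂ (c 0) (c' 0)).im])
      ((le_abs_self _).trans h1)
  · rw [← hconst t, ← hode]
    exact hd' t
  · rw [← hconst t]
    exact hin t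

/-- The inner product of two points of a magnetic geodesic of energy `k`. In the solution
`r ω = s - 1/2` and `ω² = 2 k + 1/4 - s`, where `s = Im ⟨γ, γ'⟩`. -/
theorem exists_parameters_of_nonempty [CompleteSpace H] {k : ℝ} {q₀ q₁ : USphere H}
    (h : (connectingGeodesics k q₀ q₁).Nonempty) :
    ∃ ω r τ : ℝ, |r| ≤ 1 ∧ 1 / 4 + ω ^ 2 + ω * r = 2 * k ∧
      inner ℂ (q₀ : H) (q₁ : H) =
        phase (τ / 2) * (Real.cos (ω * τ) + Complex.I * r * Real.sin (ω * τ)) := by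
  obtain ⟨γ, hγ, hk, t₀, t₁, -, rfl, rfl⟩ := h
  obtain ⟨s, hs, c', hd, hd', hin⟩ := exists_linear_equation hγ hk
  have hD : (s - 1 / 2) ^ 2 ≤ 2 * k + 1 / 4 - s := by nlinarith
  have hD0 : 0 ≤ 2 * k + 1 / 4 - s := (sq_nonneg _).trans hD
  obtain ⟨ω, hω⟩ : ∃ ω : ℝ, ω ^ 2 = 2 * k + 1 / 4 - s := ⟨_, Real.sq_sqrt hD0⟩
  set q : H := (γ t₀ : H) with hq
  have hph : ∀ t, HasDerivAt (fun t => phase (-(1 / 2) * t))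
      (Complex.I * (-(1 / 2) : ℝ) * phase (-(1 / 2) * t)) t := hasDerivAt_phase_mul _
  have hw : ∀ t, HasDerivAt (fun t => inner ℂ q (γ t : H)) (inner ℂ q (c' t)) t := fun t =>
    (innerSL ℂ q).hasFDerivAt.restrictScalars ℝ |>.comp_hasDerivAt t (hd t)
  have hw' : ∀ t, HasDerivAt (fun t => inner ℂ q (c' t))
      (Complex.I * inner ℂ q (c' t) + (s - 2 * k : ℝ) * inner ℂ q (γ t : H)) t := fun t => by
    refine ((innerSL ℂ q).hasFDerivAt.restrictScalars ℝ |>.comp_hasDerivAt t (hd' t)).congr_deriv ?_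
    change inner ℂ q (Complex.I • c' t + (s - 2 * k) • (γ t : H)) = _
    rw [inner_add_right, inner_smul_right, ← Complex.coe_smul (s - 2 * k), inner_smul_right]
  -- Multiplication by `exp (-i t / 2)` removes the first-order term of the equation.
  have hy : ∀ t, HasDerivAt (fun t => phase (-(1 / 2) * t) * inner ℂ q (γ t : H))
      (phase (-(1 / 2) * t) *
        (inner ℂ q (c' t) - Complex.I * (1 / 2) * inner ℂ q (γ t : H))) t := fun t => by
    refine ((hph t).mul (hw t)).congr_deriv ?_
    push_cast
    ring
  have hz : ∀ t, HasDerivAt (fun t => phase (-(1 / 2) * t) *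
      (inner ℂ q (c' t) - Complex.I * (1 / 2) * inner ℂ q (γ t : H)))
      (-(ω : ℂ) ^ 2 * (phase (-(1 / 2) * t) * inner ℂ q (γ t : H))) t := fun t => by
    have h := (hph t).mul ((hw' t).sub ((hw t).const_mul (Complex.I * (1 / 2))))
    refine h.congr_deriv ?_
    have hω' : (ω : ℂ) ^ 2 = 2 * k + 1 / 4 - s := by
      rw [← Complex.ofReal_pow, hω]
      push_cast
      ring
    have hI := Complex.I_sq
    simp only [Pi.sub_apply]
    push_cast
    rw [hω']
    linear_combination (1 / 4 * phase (-(1 / 2) * t) * inner ℂ q (γ t : H)) * hI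
  have hq1 : inner ℂ q q = 1 := by
    rw [inner_self_eq_norm_sq_to_K, norm_eq_of_mem_sphere]
    simp
  have hq0 : inner ℂ q (c' t₀) = Complex.I * s := hin t₀
  have hsplit : phase ((t₁ - t₀) / 2) = phase (t₁ / 2) * phase (-(1 / 2) * t₀) := by
    rw [← phase_add]
    congr 1
    ring
  have hcancel : phase (t₁ / 2) * phase (-(1 / 2) * t₁) = 1 := by
    rw [← phase_add, ← phase_zero]
    congr 1
    ring
  rcases eq_or_ne ω 0 with rfl | hω0
  -- For `ω = 0` the function `y` is affine, and its slope vanishes because `s = 1 / 2`.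
  · have hs' : s = 1 / 2 := by
      have h : (s - 1 / 2) ^ 2 = 0 := le_antisymm (by linarith) (sq_nonneg _)
      linarith [pow_eq_zero_iff two_ne_zero |>.mp h]
    refine ⟨0, 1, t₁ - t₀, by simp, by linarith, ?_⟩
    have hz0 : ∀ t, phase (-(1 / 2) * t) *
        (inner ℂ q (c' t) - Complex.I * (1 / 2) * inner ℂ q (γ t : H)) = 0 := fun t => by
      have h := is_const_of_deriv_eq_zero (fun s => (hz s).differentiableAt)
        (fun s => by rw [(hz s).deriv]; simp) t t₀
      refine h.trans ?_
      simp only [← hq, hq0, hq1, hs']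
      push_cast
      ring
    have h := is_const_of_deriv_eq_zero (fun s => (hy s).differentiableAt)
      (fun s => by rw [(hy s).deriv, hz0]) t₁ t₀
    simp only [← hq, hq1] at h
    rw [hsplit]
    simp only [zero_mul, Real.cos_zero, Real.sin_zero, Complex.ofReal_zero, Complex.ofReal_one]
    linear_combination phase (t₁ / 2) * h - inner ℂ q (γ t₁ : H) * hcancel
  · have key := harmonic_oscillator_solution hy hz t₀ t₁
    refine ⟨ω, (s - 1 / 2) / ω, t₁ - t₀, ?_, ?_, ?_⟩
    · rw [abs_div, div_le_one (abs_pos.mpr hω0), ← sq_le_sq, hω]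
      exact hD
    · rw [mul_div_cancel₀ _ hω0, hω]
      ring
    · simp only [← hq, hq0, hq1] at key
      have hωC : (ω : ℂ) ≠ 0 := Complex.ofReal_ne_zero.mpr hω0
      rw [hsplit]
      refine mul_left_cancel₀ hωC ?_
      have hr : (ω : ℂ) * ((s - 1 / 2) / ω) = s - 1 / 2 := mul_div_cancel₀ _ hωC
      push_cast at key ⊢
      linear_combination phase (t₁ / 2) * key - ω * inner ℂ q (γ t₁ : H) * hcancel
        - phase (t₁ / 2) * phase (-(1 / 2) * t₀) * Complex.I * Complex.sin (ω * (t₁ - t₀)) * hr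

end Necessity

/-! ### Which pairs of points are connected -/

section Connectivity

variable {H : Type*} [NormedAddCommGroup H] [InnerProductSpace ℂ H]

/-- The converse of `exists_parameters_of_nonempty`, for `sin (ω τ) ≠ 0`. The frequencies are
`1 / 2 ± ω` and the squared amplitudes `(1 ± r) / 2`; that `|r| ≤ 1` is automatic, since `q₀` and
`q₁` are unit vectors. -/
theorem connectingGeodesics_nonempty_of_parameters [CompleteSpace H] {k ω r τ : ℝ}
    {q₀ q₁ : USphere H} (hk : 1 / 4 + ω ^ 2 + ω * r = 2 * k) (hsin : Real.sin (ω * τ) ≠ 0)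
    (hw : inner ℂ (q₀ : H) (q₁ : H) =
      phase (τ / 2) * (Real.cos (ω * τ) + Complex.I * r * Real.sin (ω * τ))) :
    (connectingGeodesics k q₀ q₁).Nonempty := by
  have ha : phase ((1 / 2 + ω) * τ) = phase (τ / 2) * phase (ω * τ) := by
    rw [← phase_add]
    congr 1
    ring
  have hb : phase ((1 / 2 - ω) * τ) = phase (τ / 2) * phase (-(ω * τ)) := by
    rw [← phase_add]
    congr 1
    ring
  refine connectingGeodesics_nonempty_of_modes (a := 1 / 2 + ω) (b := 1 / 2 - ω)
    (p := (1 + r) / 2) (τ := τ) (by ring) (by rw [← hk]; ring) ?_ ?_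
  · rw [ha, hb, Ne, mul_right_inj' (phase_ne_zero _), phase_eq, phase_eq, Real.cos_neg,
      Real.sin_neg, add_right_inj, mul_right_inj' Complex.I_ne_zero]
    norm_cast
    intro h
    exact hsin (by linarith)
  · rw [hw, ha, hb, phase_eq (ω * τ), phase_eq (-(ω * τ)), Real.cos_neg, Real.sin_neg]
    push_cast
    ring

theorem norm_sq_of_parameters {w : ℂ} {r x τ : ℝ}
    (hw : w = phase τ * (Real.cos x + Complex.I * r * Real.sin x)) :
    ‖w‖ ^ 2 = Real.cos x ^ 2 + r ^ 2 * Real.sin x ^ 2 := by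
  rw [hw, norm_mul, norm_phase, one_mul, Complex.sq_norm, Complex.normSq_apply]
  simp [-Complex.ofReal_cos, -Complex.ofReal_sin]
  ring

theorem sq_ge_of_energy {k ω r : ℝ} (hk : 1 / 4 + ω ^ 2 + ω * r = 2 * k) : 1 - 8 * k ≤ r ^ 2 := by
  nlinarith [sq_nonneg (2 * ω + r)]

theorem sq_le_norm_sq_of_parameters {w : ℂ} {r x τ : ℝ} (hr : |r| ≤ 1)
    (hw : w = phase τ * (Real.cos x + Complex.I * r * Real.sin x)) : r ^ 2 ≤ ‖w‖ ^ 2 := by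
  have h1 : r ^ 2 ≤ 1 := (sq_le_one_iff_abs_le_one r).mpr hr
  rw [norm_sq_of_parameters hw]
  nlinarith [Real.sin_sq_add_cos_sq x, mul_nonneg (sub_nonneg.mpr h1) (sq_nonneg (Real.cos x))]

/-- If `f` is not constant, multiples `N f + g` have a range of length at least `2 π`, hence meet
every residue class modulo `2 π`. -/
theorem exists_int_mul_add_eq_mod_two_pi {f g : ℝ → ℝ} {a b : ℝ} (hab : a ≤ b)
    (hf : ContinuousOn f (Set.Icc a b)) (hg : ContinuousOn g (Set.Icc a b)) (hne : f a ≠ f b)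
    (φ : ℝ) : ∃ N m : ℤ, ∃ r ∈ Set.Icc a b, N * f r + g r = φ + 2 * Real.pi * m := by
  obtain ⟨N, hN⟩ : ∃ N : ℤ, 2 * Real.pi + (g a - g b) ≤ N * (f b - f a) := by
    obtain ⟨n, hn⟩ := Archimedean.arch (2 * Real.pi + (g a - g b))
      (abs_pos.mpr (sub_ne_zero.mpr hne.symm))
    rw [nsmul_eq_mul] at hn
    rcases abs_choice (f b - f a) with h | h
    · exact ⟨n, by rw [h] at hn; exact_mod_cast hn⟩
    · exact ⟨-n, by rw [h] at hn; push_cast; linarith⟩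
  have hπ : 0 < 2 * Real.pi := by positivity
  set y := N * f a + g a with hy
  have h1 := Int.le_ceil ((y - φ) / (2 * Real.pi))
  have h2 := Int.ceil_lt_add_one ((y - φ) / (2 * Real.pi))
  set m := ⌈(y - φ) / (2 * Real.pi)⌉
  rw [div_le_iff₀ hπ] at h1
  have h2' : (m - 1 : ℝ) < (y - φ) / (2 * Real.pi) := by linarith
  rw [lt_div_iff₀ hπ] at h2'
  obtain ⟨r, hr, hr'⟩ := intermediate_value_Icc hab ((hf.const_mul (N : ℝ)).add hg)
    (show φ + 2 * Real.pi * m ∈ Set.Icc _ _ from ⟨by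
      change N * f a + g a ≤ _
      linarith, by
      change _ ≤ N * f b + g b
      linarith⟩)
  exact ⟨N, m, r, hr, hr'⟩

/-- Existence for non-parallel points. For `r` in a subinterval of `(√(1 - 8 k), |⟨q₀, q₁⟩|)` there
is a time at which the inner product of the ends of the curve with parameter `r` has the prescribed
modulus, and this time can be chosen continuously in `r`. After `N` further periods the argument of
the inner product is `N π / ω(r)` up to a bounded continuous term, so it takes every value once `N`
is large, because `ω` is not constant. -/
theorem connectingGeodesics_nonempty_of_lt_norm_inner [CompleteSpace H] {k : ℝ} {q₀ q₁ : USphere H}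
    (h₁ : √(1 - 8 * k) < ‖inner ℂ (q₀ : H) (q₁ : H)‖) (h₂ : ‖inner ℂ (q₀ : H) (q₁ : H)‖ < 1) :
    (connectingGeodesics k q₀ q₁).Nonempty := by
  set w := inner ℂ (q₀ : H) (q₁ : H) with hw
  set l := √(1 - 8 * k) with hl
  have hl0 : 0 ≤ l := Real.sqrt_nonneg _
  set r₁ := (2 * l + ‖w‖) / 3 with hr₁
  set r₂ := (l + 2 * ‖w‖) / 3 with hr₂
  have hlr : l < r₁ := by rw [hr₁]; linarith
  have hrr : r₁ < r₂ := by rw [hr₁, hr₂]; linarith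
  have hrw : r₂ < ‖w‖ := by rw [hr₂]; linarith
  have hpos : ∀ r ∈ Set.Icc r₁ r₂, 0 < r := fun r hr => by linarith [hr.1]
  have hltw : ∀ r ∈ Set.Icc r₁ r₂, r < ‖w‖ := fun r hr => by linarith [hr.2]
  have hu : ∀ r ∈ Set.Icc r₁ r₂, 0 ≤ r ^ 2 / 4 + 2 * k - 1 / 4 := fun r hr => by
    have h : 1 - 8 * k < r ^ 2 := (Real.sqrt_lt' (hpos r hr)).mp (hlr.trans_le hr.1)
    linarith
  have hwsq : ‖w‖ ^ 2 < 1 := by nlinarith [norm_nonneg w]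
  have hrsq : ∀ r ∈ Set.Icc r₁ r₂, r ^ 2 < ‖w‖ ^ 2 := fun r hr => by
    nlinarith [hltw r hr, hpos r hr]
  let u : ℝ → ℝ := fun r => √(r ^ 2 / 4 + 2 * k - 1 / 4)
  let ω : ℝ → ℝ := fun r => -r / 2 - u r
  let S : ℝ → ℝ := fun r => √((1 - ‖w‖ ^ 2) / (1 - r ^ 2))
  let σ : ℝ → ℝ := fun r => Real.arcsin (S r)
  let G : ℝ → ℂ := fun r => (Real.cos (σ r) : ℂ) + Complex.I * r * Real.sin (σ r)
  have hωneg : ∀ r ∈ Set.Icc r₁ r₂, ω r < 0 := fun r hr => by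
    have h1 := hpos r hr
    have h2 : 0 ≤ u r := Real.sqrt_nonneg _
    change -r / 2 - u r < 0
    linarith
  have hωk : ∀ r ∈ Set.Icc r₁ r₂, 1 / 4 + ω r ^ 2 + ω r * r = 2 * k := fun r hr => by
    have h := Real.sq_sqrt (hu r hr)
    change 1 / 4 + (-r / 2 - u r) ^ 2 + (-r / 2 - u r) * r = 2 * k
    linear_combination h
  -- `S r` is the sine for which `cos² + r² sin² = ‖w‖²`.
  have hS0 : ∀ r ∈ Set.Icc r₁ r₂, 0 < S r := fun r hr =>
    Real.sqrt_pos.mpr (div_pos (by linarith) (by linarith [hrsq r hr]))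
  have hSsq : ∀ r ∈ Set.Icc r₁ r₂, S r ^ 2 * (1 - r ^ 2) = 1 - ‖w‖ ^ 2 := fun r hr => by
    have h1 : 0 < 1 - r ^ 2 := by linarith [hrsq r hr]
    rw [Real.sq_sqrt (div_nonneg (by linarith) h1.le), div_mul_cancel₀ _ h1.ne']
  have hS1 : ∀ r ∈ Set.Icc r₁ r₂, S r < 1 := fun r hr => by
    have h1 : 0 < 1 - r ^ 2 := by linarith [hrsq r hr]
    rw [Real.sqrt_lt' one_pos, one_pow, div_lt_one h1]
    linarith [hrsq r hr]
  have hsin : ∀ r ∈ Set.Icc r₁ r₂, Real.sin (σ r) = S r := fun r hr =>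
    Real.sin_arcsin (by linarith [hS0 r hr]) (hS1 r hr).le
  have hcos : ∀ r ∈ Set.Icc r₁ r₂, 0 < Real.cos (σ r) := fun r hr =>
    Real.cos_pos_of_mem_Ioo ⟨by
      linarith [Real.arcsin_pos.mpr (hS0 r hr), Real.pi_pos],
      Real.arcsin_lt_pi_div_two.mpr (hS1 r hr)⟩
  have hGnorm : ∀ r ∈ Set.Icc r₁ r₂, ‖G r‖ = ‖w‖ := fun r hr => by
    have h := norm_sq_of_parameters (w := G r) (r := r) (x := σ r) (τ := 0)
      (by rw [phase_zero, one_mul])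
    rw [← sq_eq_sq₀ (norm_nonneg _) (norm_nonneg _), h]
    have h1 := Real.sin_sq_add_cos_sq (σ r)
    rw [hsin r hr] at h1 ⊢
    linear_combination h1 - hSsq r hr
  have hωc : ContinuousOn ω (Set.Icc r₁ r₂) := Continuous.continuousOn (by fun_prop)
  have hσc : ContinuousOn σ (Set.Icc r₁ r₂) := by
    refine Real.continuous_arcsin.comp_continuousOn (ContinuousOn.sqrt ?_)
    exact continuousOn_const.div (by fun_prop) fun r hr => by linarith [hrsq r hr]
  have hGc : ContinuousOn G (Set.Icc r₁ r₂) := by fun_prop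
  have hGs : ∀ r ∈ Set.Icc r₁ r₂, G r ∈ Complex.slitPlane := fun r hr => by
    left
    simpa [G, -Complex.ofReal_cos, -Complex.ofReal_sin] using hcos r hr
  have hargc : ContinuousOn (fun r => (G r).arg) (Set.Icc r₁ r₂) := fun r hr =>
    (Complex.continuousAt_arg (hGs r hr)).comp_continuousWithinAt (hGc r hr)
  have hωne : ω r₂ < ω r₁ := by
    have h : u r₁ ≤ u r₂ := Real.sqrt_le_sqrt (by
      have := hpos r₁ ⟨le_rfl, hrr.le⟩
      nlinarith)
    change -r₂ / 2 - u r₂ < -r₁ / 2 - u r₁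
    linarith
  obtain ⟨N, m, r, hr, hN⟩ := exists_int_mul_add_eq_mod_two_pi (f := fun r => Real.pi / ω r)
    (g := fun r => σ r / (2 * ω r) + (G r).arg) hrr.le
    (continuousOn_const.div hωc fun r hr => (hωneg r hr).ne)
    ((hσc.div (hωc.const_mul 2) fun r hr => mul_ne_zero two_ne_zero (hωneg r hr).ne).add hargc)
    (fun h => hωne.ne (mul_left_cancel₀ Real.pi_ne_zero ((div_eq_div_iff
      (hωneg r₁ ⟨le_rfl, hrr.le⟩).ne (hωneg r₂ ⟨hrr.le, le_rfl⟩).ne).mp h))) w.arg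
  have hω0 : ω r ≠ 0 := (hωneg r hr).ne
  have hx : ω r * ((σ r + N * (2 * Real.pi)) / ω r) = σ r + N * (2 * Real.pi) :=
    mul_div_cancel₀ _ hω0
  refine connectingGeodesics_nonempty_of_parameters (hωk r hr)
    (τ := (σ r + N * (2 * Real.pi)) / ω r) ?_ ?_
  · rw [hx, Real.sin_add_int_mul_two_pi, hsin r hr]
    exact (hS0 r hr).ne'
  · rw [hx, Real.sin_add_int_mul_two_pi, Real.cos_add_int_mul_two_pi]
    have hpol : ∀ z : ℂ, z = ‖z‖ * phase z.arg := fun z => by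
      rw [phase, mul_comm Complex.I, Complex.norm_mul_exp_arg_mul_I]
    change w = phase _ * G r
    have hm : phase (2 * Real.pi * m) = 1 := by
      rw [phase_eq, mul_comm, Real.cos_int_mul_two_pi, mul_comm (m : ℝ), mul_comm (2 * Real.pi),
        show (m : ℝ) * (2 * Real.pi) = 0 + m * (2 * Real.pi) by ring, Real.sin_add_int_mul_two_pi]
      simp
    rw [hpol (G r), hGnorm r hr, mul_left_comm, ← phase_add]
    have harg : (σ r + N * (2 * Real.pi)) / ω r / 2 + (G r).arg = w.arg + 2 * Real.pi * m := by
      rw [← hN]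
      field_simp
      ring
    rw [harg, phase_add, hm, mul_one]
    exact hpol w

theorem connectingGeodesics_nonempty_of_inner_eq_zero [CompleteSpace H] {k : ℝ} (hk : 1 / 8 < k)
    {q₀ q₁ : USphere H} (hw : inner ℂ (q₀ : H) (q₁ : H) = 0) :
    (connectingGeodesics k q₀ q₁).Nonempty := by
  have h0 : 0 < 2 * k - 1 / 4 := by linarith
  have hω := Real.sqrt_pos.mpr h0
  have hx := mul_div_cancel₀ (Real.pi / 2) hω.ne'
  refine connectingGeodesics_nonempty_of_parameters (ω := √(2 * k - 1 / 4)) (r := 0)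
    (τ := Real.pi / 2 / √(2 * k - 1 / 4)) ?_ ?_ ?_
  · rw [Real.sq_sqrt h0.le]
    ring
  · rw [hx, Real.sin_pi_div_two]
    exact one_ne_zero
  · rw [hx, hw, Real.cos_pi_div_two]
    simp

theorem norm_inner_le_one (q₀ q₁ : USphere H) : ‖inner ℂ (q₀ : H) (q₁ : H)‖ ≤ 1 := by
  simpa using norm_inner_le_norm (𝕜 := ℂ) (q₀ : H) (q₁ : H)

theorem connectingGeodesics_nonempty_of_sqrt_lt [CompleteSpace H] {k : ℝ} (hk : 0 < k)
    {q₀ q₁ : USphere H} (h : √(1 - 8 * k) < ‖inner ℂ (q₀ : H) (q₁ : H)‖) :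
    (connectingGeodesics k q₀ q₁).Nonempty := by
  rcases (norm_inner_le_one q₀ q₁).lt_or_eq with h1 | h1
  · exact connectingGeodesics_nonempty_of_lt_norm_inner h h1
  · exact connectingGeodesics_nonempty_of_norm_inner_eq_one hk h1

theorem connectingGeodesics_nonempty_of_supercritical [CompleteSpace H] {k : ℝ} (hk : 1 / 8 < k)
    (q₀ q₁ : USphere H) : (connectingGeodesics k q₀ q₁).Nonempty := by
  by_cases hw : inner ℂ (q₀ : H) (q₁ : H) = 0
  · exact connectingGeodesics_nonempty_of_inner_eq_zero hk hw
  · refine connectingGeodesics_nonempty_of_sqrt_lt (by linarith) ?_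
    rw [Real.sqrt_eq_zero_of_nonpos (by linarith)]
    exact norm_pos_iff.mpr hw

theorem connectingGeodesics_critical_nonempty_iff [CompleteSpace H] (q₀ q₁ : USphere H) :
    (connectingGeodesics (1 / 8) q₀ q₁).Nonempty ↔ inner ℂ (q₀ : H) (q₁ : H) ≠ 0 := by
  constructor
  · intro h hw
    obtain ⟨ω, r, τ, hr, hk, hw'⟩ := exists_parameters_of_nonempty h
    have h1 := sq_le_norm_sq_of_parameters hr hw'
    have h2 := norm_sq_of_parameters hw'
    rw [hw, norm_zero] at h1 h2
    obtain rfl : r = 0 := by nlinarith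
    obtain rfl : ω = 0 := by nlinarith
    simp at h2
  · intro hw
    refine connectingGeodesics_nonempty_of_sqrt_lt (by norm_num) ?_
    rw [Real.sqrt_eq_zero_of_nonpos (by norm_num)]
    exact norm_pos_iff.mpr hw

theorem connectingGeodesics_eq_empty_of_norm_inner_lt [CompleteSpace H] {k : ℝ} {q₀ q₁ : USphere H}
    (h : ‖inner ℂ (q₀ : H) (q₁ : H)‖ < √(1 - 8 * k)) : connectingGeodesics k q₀ q₁ = ∅ := by
  by_contra hne
  obtain ⟨ω, r, τ, hr, hk, hw⟩ :=
    exists_parameters_of_nonempty (Set.nonempty_iff_ne_empty.mpr hne)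
  exact h.not_ge (Real.sqrt_le_iff.mpr ⟨norm_nonneg _,
    (sq_ge_of_energy hk).trans (sq_le_norm_sq_of_parameters hr hw)⟩)

/-- On the boundary of the reachable set, `r = ±ρ` and `ω = -r / 2`, and the curve has to be
followed for an odd number of quarter periods, `ω τ = π / 2 + m π`; this leaves a discrete set of
arguments. -/
theorem connectingGeodesics_nonempty_iff_of_norm_inner_eq [CompleteSpace H] {k : ℝ} (hk0 : 0 < k)
    (hk1 : k < 1 / 8) {q₀ q₁ : USphere H} (h : ‖inner ℂ (q₀ : H) (q₁ : H)‖ = √(1 - 8 * k)) :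
    (connectingGeodesics k q₀ q₁).Nonempty ↔ ∃ m : ℤ, inner ℂ (q₀ : H) (q₁ : H) =
      phase (Real.pi / 2 * (1 / √(1 - 8 * k) - 1) + m * (Real.pi * (1 / √(1 - 8 * k) - 1))) *
        ((√(1 - 8 * k) : ℝ) : ℂ) := by
  set ρ := √(1 - 8 * k) with hρ
  have hρ0 : 0 < ρ := Real.sqrt_pos.mpr (by linarith)
  have hρsq : ρ ^ 2 = 1 - 8 * k := Real.sq_sqrt (by linarith)
  have hneg : ∀ x, Real.cos x = 0 → phase (-x) = -phase x := fun x hx => by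
    rw [phase_eq, phase_eq, Real.cos_neg, Real.sin_neg, hx]
    push_cast
    ring
  constructor
  · intro hne
    obtain ⟨ω, r, τ, hr, hk, hw⟩ := exists_parameters_of_nonempty hne
    have h1 := sq_ge_of_energy hk
    have h2 := sq_le_norm_sq_of_parameters hr hw
    have h3 := norm_sq_of_parameters hw
    rw [h] at h2 h3
    have hr2 : r ^ 2 = ρ ^ 2 := by linarith
    have hω : ω = -r / 2 := by
      have : (2 * ω + r) ^ 2 = 0 := by linarith
      linarith [pow_eq_zero_iff two_ne_zero |>.mp this]
    have hcos : Real.cos (ω * τ) = 0 := by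
      have h4 : 8 * k * Real.cos (ω * τ) ^ 2 = 0 := by
        rw [hr2] at h3
        have h5 := Real.sin_sq_add_cos_sq (ω * τ)
        linear_combination Real.cos (ω * τ) ^ 2 * hρsq + (-ρ ^ 2) * h5 - h3
      exact pow_eq_zero_iff two_ne_zero |>.mp ((mul_eq_zero.mp h4).resolve_left (by linarith))
    obtain ⟨n, hn⟩ := Real.cos_eq_zero_iff.mp hcos
    have hw2 : inner ℂ (q₀ : H) (q₁ : H) = r * (phase (τ / 2) * phase (ω * τ)) := by
      rw [hw, phase_eq (ω * τ), hcos]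
      push_cast
      ring
    rcases sq_eq_sq_iff_eq_or_eq_neg.mp hr2 with hrρ | hrρ
    · refine ⟨-n - 1, ?_⟩
      -- The two signs of `r` give opposite angles; `n ↦ -n - 1` exchanges the two families.
      have hτ : τ / 2 = -(ω * τ) / ρ := by
        rw [hω, hrρ]
        field_simp
      rw [hw2, ← phase_add, mul_comm, hrρ, hτ, hn]
      congr 2
      push_cast
      field_simp
      ring
    · refine ⟨n, ?_⟩
      have hτ : τ / 2 = (ω * τ) / ρ := by
        rw [hω, hrρ]
        field_simp
      rw [hw2, hrρ, Complex.ofReal_neg, neg_mul, ← mul_neg, ← mul_neg, ← hneg _ hcos, ← phase_add,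
        mul_comm, hτ, hn]
      congr 2
      field_simp
      ring
  · rintro ⟨m, hm⟩
    set x : ℝ := (2 * m + 1) * Real.pi / 2 with hx
    have hcos : Real.cos x = 0 := Real.cos_eq_zero_iff.mpr ⟨m, rfl⟩
    have hxρ : ρ / 2 * (2 * x / ρ) = x := by
      field_simp
    refine connectingGeodesics_nonempty_of_parameters (ω := ρ / 2) (r := -ρ)
      (τ := 2 * x / ρ) ?_ ?_ ?_
    · linarith
    · rw [hxρ]
      intro hsin
      have h5 := Real.sin_sq_add_cos_sq x
      rw [hsin, hcos] at h5
      norm_num at h5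
    · have e : Real.pi / 2 * (1 / ρ - 1) + m * (Real.pi * (1 / ρ - 1)) = 2 * x / ρ / 2 + -x := by
        rw [hx]
        field_simp
        ring
      rw [hm, e, phase_add, hneg x hcos, phase_eq x, hxρ, hcos]
      push_cast
      ring

end Connectivity

/-! ### The critical value -/

section Mane

attribute [local instance] InnerProductSpace.complexToReal

variable {H : Type*} [NormedAddCommGroup H] [InnerProductSpace ℂ H]

theorem contactForm_apply (f : USphere H) (v : Tan f) :
    contactForm f v = 1 / 2 * inner ℝ (Complex.I • (f : H)) (v : H) :=
  ambientForm_apply (f : H) (v : H)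

theorem norm_I_smul_coe (f : USphere H) : ‖Complex.I • (f : H)‖ = 1 := by
  rw [norm_smul, Complex.norm_I, one_mul, norm_eq_of_mem_sphere]

theorem abs_contactForm_le (f : USphere H) (v : Tan f) : |contactForm f v| ≤ 1 / 2 * ‖v‖ := by
  have h := abs_real_inner_le_norm (Complex.I • (f : H)) (v : H)
  rw [norm_I_smul_coe, one_mul] at h
  rw [contactForm_apply, abs_mul, abs_of_pos (by norm_num : (0 : ℝ) < 1 / 2)]
  exact mul_le_mul_of_nonneg_left h (by norm_num)

/-- The norm of `α_f` is attained at the Reeb direction `i f`. -/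
theorem norm_contactForm (f : USphere H) : ‖contactForm f‖ = 1 / 2 := by
  refine le_antisymm (ContinuousLinearMap.opNorm_le_bound _ (by norm_num) (abs_contactForm_le f)) ?_
  have hmem : Complex.I • (f : H) ∈ Tan f := by
    rw [mem_tan_iff, inner_smul_right, inner_self_eq_norm_sq_to_K, norm_eq_of_mem_sphere]
    simp
  have h := (contactForm f).le_opNorm ⟨_, hmem⟩
  rw [contactForm_apply, real_inner_self_eq_norm_sq, Submodule.coe_norm, norm_I_smul_coe] at h
  norm_num at h ⊢
  exact h

theorem contactFormSupNorm_eq [Nonempty (USphere H)] :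
    contactFormSupNorm H = ENNReal.ofReal (1 / 2) := by
  have h : ∀ f : USphere H, ‖contactForm f‖ₑ = ENNReal.ofReal (1 / 2) := fun f => by
    rw [← ofReal_norm, norm_contactForm]
  rw [contactFormSupNorm, iSup_congr h, iSup_const]

/-- From energy `1/8` on the Lagrangian is pointwise nonnegative, as `½ v² - ½ v + ⅛ = ½ (v - ½)²`;
a non-integrable integrand has integral `0`, which does no harm. -/
theorem action_nonneg {k T : ℝ} (hk : 1 / 8 ≤ k) (hT : 0 ≤ T) (γ : ℝ → USphere H)
    (V : ∀ t, Tan (γ t)) : 0 ≤ action k T γ V := by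
  refine intervalIntegral.integral_nonneg hT fun t _ => ?_
  have h := (le_abs_self _).trans (abs_contactForm_le (γ t) (V t))
  rw [lagrangian]
  nlinarith [sq_nonneg (‖V t‖ - 1 / 2)]

/-- A Hopf circle traversed at speed `½`, the minimizer of `½ v² - ½ v`, has action
`4 π (k - 1/8)`. -/
theorem exists_loop_action [CompleteSpace H] (q : USphere H) (k : ℝ) :
    ∃ (γ : ℝ → USphere H) (V : ∀ t, Tan (γ t)), IsH1Curve (4 * Real.pi) γ V ∧
      γ 0 = γ (4 * Real.pi) ∧ action k (4 * Real.pi) γ V = 4 * Real.pi * (k - 1 / 8) := by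
  obtain ⟨γ, hγ, -, hvel⟩ := twoMode_isMagneticGeodesic (a := 1 / 2) (b := 1 / 2) (A := (q : H))
    (B := 0) (by norm_num) (inner_zero_right _) (by simp)
  have hc : (fun t => (γ t : H)) = twoMode (1 / 2) (1 / 2) (q : H) 0 := funext hγ
  have hV : ∀ t, (velocity γ t : H) = (1 / 2 : ℝ) • Complex.I • (γ t : H) := fun t => by
    change deriv (fun t => (γ t : H)) t = _
    rw [hγ, hc, deriv_twoMode]
    simp only [twoMode, smul_zero, add_zero, ← Complex.coe_smul (1 / 2 : ℝ), smul_smul]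
    congr 1
    ring
  have hcont : Continuous fun t => (γ t : H) := by
    rw [hc]
    exact (contDiff_twoMode (n := 0) _ _ _ _).continuous
  have hVcont : Continuous fun t => (velocity γ t : H) := by
    simp only [hV]
    fun_prop
  have hnorm : ∀ t, ‖velocity γ t‖ ^ 2 = 1 / 4 := fun t => by
    rw [hvel, norm_eq_of_mem_sphere]
    norm_num
  refine ⟨γ, velocity γ, ⟨?_, fun t _ => ?_⟩, Subtype.ext ?_, ?_⟩
  · refine MemLp.of_bound hVcont.aestronglyMeasurable 1 (Filter.Eventually.of_forall fun t => ?_)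
    have h := hnorm t
    rw [Submodule.coe_norm] at h
    nlinarith
  · rw [intervalIntegral.integral_eq_sub_of_hasDerivAt (f := fun t => (γ t : H)) (fun s _ => ?_)
      (hVcont.intervalIntegrable _ _)]
    · abel
    · have h : DifferentiableAt ℝ (fun t => (γ t : H)) s := by
        rw [hc]
        exact (hasDerivAt_twoMode _ _ _ _ s).differentiableAt
      exact h.hasDerivAt
  · rw [hγ, hγ, twoMode, twoMode, mul_zero, show 1 / 2 * (4 * Real.pi) = 2 * Real.pi by ring,
      phase_zero, phase_eq, Real.cos_two_pi, Real.sin_two_pi]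
    simp
  · have h : ∀ t, lagrangian (γ t) (velocity γ t) + k = k - 1 / 8 := fun t => by
      rw [lagrangian, hnorm, contactForm_apply, hV, real_inner_smul_right,
        real_inner_self_eq_norm_sq, norm_I_smul_coe]
      ring
    simp only [action, h]
    rw [intervalIntegral.integral_const, smul_eq_mul, sub_zero]

theorem maneCriticalValue_eq [CompleteSpace H] [Nonempty (USphere H)] :
    maneCriticalValue H = ((1 / 8 : ℝ) : EReal) := by
  refine IsLeast.csInf_eq ⟨⟨1 / 8, fun T hT γ V _ _ => action_nonneg le_rfl hT.le γ V, rfl⟩, ?_⟩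
  rintro _ ⟨k, hk, rfl⟩
  obtain ⟨γ, V, hγ, hloop, hact⟩ := exists_loop_action (Classical.arbitrary (USphere H)) k
  have h := hk _ (by positivity) γ V hγ hloop
  rw [hact] at h
  have h' := (mul_nonneg_iff_of_pos_left (by positivity : (0 : ℝ) < 4 * Real.pi)).mp h
  exact EReal.coe_le_coe_iff.mpr (by linarith)

end Mane

/-! ### Orthogonal points of the unit sphere of `L²` -/

theorem exists_inner_eq_zero : ∃ q₀ q₁ : USphere L2Circle,
    inner ℂ (q₀ : L2Circle) (q₁ : L2Circle) = 0 := by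
  have key : ∀ μ : Measure UnitAddCircle, μ = AddCircle.haarAddCircle →
      ∃ q₀ q₁ : USphere (Lp ℂ 2 μ), inner ℂ (q₀ : Lp ℂ 2 μ) (q₁ : Lp ℂ 2 μ) = 0 := by
    rintro μ rfl
    have h := orthonormal_fourier (T := 1)
    exact ⟨⟨fourierLp 2 0, by simpa using h.1 0⟩, ⟨fourierLp 2 1, by simpa using h.1 1⟩,
      h.2 zero_ne_one⟩
  -- On the circle of length `1` the Lebesgue and Haar measures agree.
  refine key _ ?_
  have h := AddCircle.volume_eq_smul_haarAddCircle (T := 1)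
  rwa [ENNReal.ofReal_one, one_smul] at h

end MagneticSphere

end

open MagneticSphere in
theorem theoremt :
    (maneCriticalValue L2Circle = ((contactFormSupNorm L2Circle ^ 2 / 2 : ℝ≥0∞) : EReal) ∧
      maneCriticalValue L2Circle = ((1 / 8 : ℝ) : EReal)) ∧
    (∀ k : ℝ, 1 / 8 < k → ∀ q₀ q₁ : USphere L2Circle, (connectingGeodesics k q₀ q₁).Nonempty) ∧
    (∀ q₀ q₁ : USphere L2Circle, (connectingGeodesics (1 / 8) q₀ q₁).Nonempty ↔
      inner ℂ (q₀ : L2Circle) (q₁ : L2Circle) ≠ 0) ∧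
    (∀ k : ℝ, 0 < k → k < 1 / 8 →
      (∀ q₀ q₁ : USphere L2Circle,
        √(1 - 8 * k) < ‖inner ℂ (q₀ : L2Circle) (q₁ : L2Circle)‖ →
          (connectingGeodesics k q₀ q₁).Nonempty) ∧
      (∃ a b : ℝ, 0 < b ∧ ∀ q₀ q₁ : USphere L2Circle,
        ‖inner ℂ (q₀ : L2Circle) (q₁ : L2Circle)‖ = √(1 - 8 * k) →
          ((connectingGeodesics k q₀ q₁).Nonempty ↔
            ∃ m : ℤ, inner ℂ (q₀ : L2Circle) (q₁ : L2Circle) =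
              Complex.exp (Complex.I * ((a + m * b : ℝ) : ℂ)) * ((√(1 - 8 * k) : ℝ) : ℂ))) ∧
      (∀ q₀ q₁ : USphere L2Circle,
        ‖inner ℂ (q₀ : L2Circle) (q₁ : L2Circle)‖ < √(1 - 8 * k) →
          connectingGeodesics k q₀ q₁ = ∅)) ∧
    (∀ k : ℝ, 0 < k → (maneCriticalValue L2Circle < (k : EReal) ↔
      ∀ q₀ q₁ : USphere L2Circle, (connectingGeodesics k q₀ q₁).Nonempty)) := by

  obtain ⟨p₀, p₁, hp⟩ := exists_inner_eq_zero
  have : Nonempty (USphere L2Circle) := ⟨p₀⟩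
  have hc := maneCriticalValue_eq (H := L2Circle)
  refine ⟨⟨?_, hc⟩, fun k hk => connectingGeodesics_nonempty_of_supercritical hk,
    connectingGeodesics_critical_nonempty_iff, fun k hk0 hk1 =>
      ⟨fun q₀ q₁ => connectingGeodesics_nonempty_of_sqrt_lt hk0, ?_,
        fun q₀ q₁ => connectingGeodesics_eq_empty_of_norm_inner_lt⟩, fun k hk0 => ?_⟩
  · have h : (ENNReal.ofReal (1 / 2) ^ 2 / 2 : ℝ≥0∞) = ENNReal.ofReal (1 / 8) := by
      rw [← ENNReal.ofReal_pow (by norm_num), ← ENNReal.ofReal_ofNat 2,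
        ← ENNReal.ofReal_div_of_pos (by norm_num)]
      norm_num
    rw [hc, contactFormSupNorm_eq, h, EReal.coe_ennreal_ofReal, max_eq_left (by norm_num)]
  · have hρ0 : 0 < √(1 - 8 * k) := Real.sqrt_pos.mpr (by linarith)
    have hρ1 : √(1 - 8 * k) < 1 := (Real.sqrt_lt' one_pos).mpr (by linarith)
    refine ⟨Real.pi / 2 * (1 / √(1 - 8 * k) - 1), Real.pi * (1 / √(1 - 8 * k) - 1),
      mul_pos Real.pi_pos (sub_pos.mpr (one_lt_one_div hρ0 hρ1)), fun q₀ q₁ h => ?_⟩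
    exact connectingGeodesics_nonempty_iff_of_norm_inner_eq hk0 hk1 h
  · rw [hc, EReal.coe_lt_coe_iff]
    refine ⟨connectingGeodesics_nonempty_of_supercritical, fun h => ?_⟩
    by_contra hk
    have hne := h p₀ p₁
    rcases (not_lt.mp hk).lt_or_eq with hlt | rfl
    · refine hne.ne_empty (connectingGeodesics_eq_empty_of_norm_inner_lt ?_)
      rw [hp, norm_zero]
      exact Real.sqrt_pos.mpr (by linarith)
    · exact (connectingGeodesics_critical_nonempty_iff p₀ p₁).mp hne hp
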